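/- Let $\mathcal M,\mathcal P\subseteq\mathbb R^d$ be regular (embedded) smooth submanifolds, with or without boundary, of dimensions $m<d$ and $p<d$ respectively. Two submanifolds without boundary are said to \emph{perfectly align} if there is a point $x$ in their intersection at which they are not transversal, i.e. at which the sum of their tangent spaces is not all of $\mathbb R^d$. Two submanifolds with or without boundary perfectly align if at least one of the four boundary-free pairs $(\operatorname{Int}\mathcal M,\operatorname{Int}\mathcal P)$, $(\operatorname{Int}\mathcal M,\partial\mathcal P)$, $(\partial\mathcal M,\operatorname{Int}\mathcal P)$, $(\partial\mathcal M,\partial\mathcal P)$ perfectly aligns. Assume that $\mathcal M$ and $\mathcal P$ do not perfectly align. Let $\mathbb P_r,\mathbb P_g$ be Borel probability measures on $\mathbb R^d$ carried by $\mathcal M$ and $\mathcal P$ respectively, i.e. $\mathbb P_r(\mathbb R^d\setminus\mathcal M)=0$ and $\mathbb P_g(\mathbb R^d\setminus\mathcal P)=0$. Assume that they are continuous in their respective manifolds: if $A\subseteq\mathcal M$ has $m$-dimensional (Hausdorff, equivalently Riemannian) measure $0$ then $\mathbb P_r(A)=0$, and if $A\subseteq\mathcal P$ has $p$-dimensional measure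 $0$ then $\mathbb P_g(A)=0$. Then $$\mathrm{JSD}(\mathbb P_r\|\mathbb P_g)=\log 2,\qquad \mathrm{KL}(\mathbb P_r\|\mathbb P_g)=+\infty,\qquad \mathrm{KL}(\mathbb P_g\|\mathbb P_r)=+\infty,$$ where $\mathrm{KL}(\mu\|\nu)=\int\log\frac{d\mu}{d\nu}\,d\mu$ if $\mu\ll\nu$, and $+\infty$ otherwise, and $\mathrm{JSD}(\mu\|\nu)=\tfrac12\mathrm{KL}\big(\mu\,\big\|\,\tfrac{\mu+\nu}2\big)+\tfrac12\mathrm{KL}\big(\nu\,\big\|\,\tfrac{\mu+\nu}2\big)$. -/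

import Mathlib

open MeasureTheory Set Filter Topology
open scoped ContDiff ENNReal

namespace GANDivergence

/-- The ambient space `ℝ^d` with its Euclidean norm. -/
abbrev E (d : ℕ) : Type := EuclideanSpace ℝ (Fin d)

/-- The coordinate subspace `ℝ^m × {0} ⊆ ℝ^d`. -/
def slice (d m : ℕ) : Set (E d) := {y | ∀ i : Fin d, m ≤ (i : ℕ) → y i = 0}

/-- The closed half of `ℝ^m × {0} ⊆ ℝ^d` on which the `m`-th coordinate (the one with index `m - 1`)
is nonnegative. For `1 ≤ m ≤ d` its boundary inside `slice d m` is `slice d (m - 1)`. -/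
def halfSlice (d m : ℕ) : Set (E d) :=
  {y | y ∈ slice d m ∧ ∀ i : Fin d, (i : ℕ) + 1 = m → 0 ≤ y i}

/-- `φ` is a smooth diffeomorphism between two open subsets of `ℝ^d`. -/
def IsSmoothChart {d : ℕ} (φ : OpenPartialHomeomorph (E d) (E d)) : Prop :=
  ContDiffOn ℝ ∞ φ φ.source ∧ ContDiffOn ℝ ∞ φ.symm φ.target

/-- The chart `φ` straightens `M` onto the model set `S`: `φ(U ∩ M) = φ(U) ∩ S` with `U` the
domain of `φ`. -/
def Straightens {d : ℕ} (φ : OpenPartialHomeomorph (E d) (E d)) (M S : Set (E d)) : Prop :=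
  ∀ y ∈ φ.source, (y ∈ M ↔ φ y ∈ S)

/-- `Int M`: the points of `M` around which `M` is an `m`-dimensional slice in a smooth chart of
`ℝ^d`. -/
def manifoldInterior {d : ℕ} (m : ℕ) (M : Set (E d)) : Set (E d) :=
  {x | x ∈ M ∧ ∃ φ : OpenPartialHomeomorph (E d) (E d),
    IsSmoothChart φ ∧ x ∈ φ.source ∧ Straightens φ M (slice d m)}

/-- `∂M`: the points of `M` around which `M` is an `m`-dimensional half-slice in a smooth chart of
`ℝ^d` that sends the point to the boundary of the half-slice. Empty for `m = 0`. -/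
def manifoldBoundary {d : ℕ} (m : ℕ) (M : Set (E d)) : Set (E d) :=
  {x | x ∈ M ∧ 1 ≤ m ∧ ∃ φ : OpenPartialHomeomorph (E d) (E d),
    IsSmoothChart φ ∧ x ∈ φ.source ∧ Straightens φ M (halfSlice d m) ∧ φ x ∈ slice d (m - 1)}

/-- `M` is a regular (that is, embedded) smooth `m`-dimensional submanifold of `ℝ^d`, with or
without boundary. -/
def IsRegularSubmanifold {d : ℕ} (m : ℕ) (M : Set (E d)) : Prop :=
  m ≤ d ∧ ∀ x ∈ M, x ∈ manifoldInterior m M ∨ x ∈ manifoldBoundary m M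

/-- The velocities at `x` of the smooth curves through `x` that stay in `S`. -/
def curveVelocities {d : ℕ} (S : Set (E d)) (x : E d) : Set (E d) :=
  {v | ∃ ε > (0 : ℝ), ∃ γ : ℝ → E d, ContDiffOn ℝ ∞ γ (Ioo (-ε) ε) ∧
    (∀ t ∈ Ioo (-ε) ε, γ t ∈ S) ∧ γ 0 = x ∧ HasDerivAt γ v 0}

/-- The tangent space `T_x S ⊆ ℝ^d`. If `S` is a submanifold without boundary and `x ∈ S`, the
velocities already form a linear subspace, and taking the span adds nothing. -/
def tangentSpaceAt {d : ℕ} (S : Set (E d)) (x : E d) : Submodule ℝ (E d) :=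
  Submodule.span ℝ (curveVelocities S x)

/-- `S` and `T` intersect transversally in `x`: `T_x S + T_x T = ℝ^d`. -/
def TransversalAt {d : ℕ} (S T : Set (E d)) (x : E d) : Prop :=
  tangentSpaceAt S x ⊔ tangentSpaceAt T x = ⊤

/-- Perfect alignment of submanifolds without boundary. -/
def PerfectlyAlignBoundaryless {d : ℕ} (S T : Set (E d)) : Prop :=
  ∃ x ∈ S ∩ T, ¬ TransversalAt S T x

/-- Perfect alignment of an `m`-dimensional submanifold `M` and a `p`-dimensional submanifold `P`,
with or without boundary. -/
def PerfectlyAlign {d : ℕ} (m p : ℕ) (M P : Set (E d)) : Prop :=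
  PerfectlyAlignBoundaryless (manifoldInterior m M) (manifoldInterior p P) ∨
  PerfectlyAlignBoundaryless (manifoldInterior m M) (manifoldBoundary p P) ∨
  PerfectlyAlignBoundaryless (manifoldBoundary m M) (manifoldInterior p P) ∨
  PerfectlyAlignBoundaryless (manifoldBoundary m M) (manifoldBoundary p P)

/-- `μ` is continuous in the `m`-dimensional submanifold `M`: sets of measure zero in `M` are
`μ`-null. The measure of subsets of `M` is the `m`-dimensional Hausdorff measure, which on an
`m`-dimensional submanifold is the Riemannian volume up to a positive constant factor. -/
def ContinuousInManifold {d : ℕ} (m : ℕ) (M : Set (E d)) (μ : Measure (E d)) : Prop :=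
  ∀ A ⊆ M, (Measure.hausdorffMeasure (m : ℝ) : Measure (E d)) A = 0 → μ A = 0

/-- The Jensen–Shannon divergence `½ KL(μ ‖ (μ + ν)/2) + ½ KL(ν ‖ (μ + ν)/2)`, with values in
`[0, ∞]`. -/
noncomputable def jsDiv {Ω : Type*} [MeasurableSpace Ω] (μ ν : Measure Ω) : ℝ≥0∞ :=
  (InformationTheory.klDiv μ ((2 : ℝ≥0∞)⁻¹ • (μ + ν)) +
    InformationTheory.klDiv ν ((2 : ℝ≥0∞)⁻¹ • (μ + ν))) / 2

end GANDivergence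

/-!
If `Pr` gives no mass to `P`, then `Pr` and `Pg` are mutually singular, and the three values follow:
neither measure is absolutely continuous with respect to the other, and each has density `2` almost
surely with respect to the mixture `(Pr + Pg) / 2`. As `Pr` is carried by `M` and is continuous in
`M`, it is enough that `M ∩ P` is null for the `m`-dimensional Hausdorff measure
(`hausdorffMeasure_inter_eq_zero`). The question is local, and `M` splits into two parts.

* Near a point of `Int M ∩ P`, let `φ` be a chart straightening `M` and `ψ` a chart straightening
  `P`. Since `p < d`, the last coordinate of `ψ` vanishes on `P`, so in the coordinates `φ` the set
  `Int M ∩ P` lies in the zero set of a smooth function `f` on an open subset of `ℝ^m`. Its points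
  lie in `Int P` or in `∂P`, and transversality with either one forces `f' ≠ 0` there: if `f' = 0`,
  both tangent spaces would lie in the hyperplane on which the last coordinate of `dψ` vanishes. A
  zero set with `f' ≠ 0` is Lebesgue null, because `f'` vanishes at its density points
  (`measure_zeroSet_fderiv_ne_zero`). Only the easy inclusions are used for the tangent spaces,
  namely that velocities of curves in a submanifold are annihilated by the differentials of its
  defining functions.
* `M \ Int M` consists of boundary points, and in a chart around one of them it lies in the wall of
  the half-slice, as the points of `M` off the wall are interior. So it has dimension at most
  `m - 1`. Working with the complement of `Int M` instead of `∂M` makes it unnecessary to know that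
  interior and boundary are disjoint.

Null sets are carried from coordinates to `ℝ^d` by the locally Lipschitz inverse charts.
-/

namespace GANDivergence

/-! ### Divergences of mutually singular probability measures -/

/-- With respect to the mixture `(μ + ν) / 2`, the density of `μ` is `2` on a set carrying `μ` and
null for `ν`, and `0` elsewhere. -/
theorem klDiv_half_add_of_mutuallySingular {Ω : Type*} [MeasurableSpace Ω] {μ ν : Measure Ω}
    [IsProbabilityMeasure μ] [IsProbabilityMeasure ν] (h : μ ⟂ₘ ν) :
    InformationTheory.klDiv μ ((2 : ℝ≥0∞)⁻¹ • (μ + ν)) = ENNReal.ofReal (Real.log 2) := by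
  obtain ⟨s, hs, hμ, hν⟩ := h
  set ρ : Measure Ω := (2 : ℝ≥0∞)⁻¹ • (μ + ν) with hρ
  have hρu : ρ univ = 1 := by
    simp only [hρ, Measure.smul_apply, Measure.add_apply, measure_univ, smul_eq_mul,
      one_add_one_eq_two]
    exact ENNReal.inv_mul_cancel (by simp) (by simp)
  have : IsProbabilityMeasure ρ := ⟨hρu⟩
  have hmeas : Measurable (sᶜ.indicator fun _ : Ω => (2 : ℝ≥0∞)) :=
    measurable_const.indicator hs.compl
  have hdens : μ = ρ.withDensity (sᶜ.indicator fun _ => 2) := by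
    ext t ht
    have hνt : ν (t ∩ sᶜ) = 0 := measure_mono_null inter_subset_right hν
    have hμt : μ (t ∩ sᶜ) = μ t := by
      rw [← sdiff_eq, measure_sdiff_null hμ]
    rw [withDensity_indicator hs.compl, withDensity_const, Measure.smul_apply,
      Measure.restrict_apply ht, hρ, Measure.smul_apply, Measure.add_apply, hνt, hμt, add_zero,
      smul_eq_mul, smul_eq_mul, ← mul_assoc, ENNReal.mul_inv_cancel (by simp) (by simp), one_mul]
  have hac : μ ≪ ρ := hdens ▸ withDensity_absolutelyContinuous _ _
  have hrn : μ.rnDeriv ρ =ᵐ[ρ] sᶜ.indicator fun _ => 2 := by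
    conv_lhs => rw [hdens]
    exact Measure.rnDeriv_withDensity ρ hmeas
  have hllr : llr μ ρ =ᵐ[μ] fun _ => Real.log 2 := by
    filter_upwards [hac.ae_le hrn, measure_eq_zero_iff_ae_notMem.1 hμ] with x hx hxs
    simp [llr, hx, hxs]
  have hint : Integrable (llr μ ρ) μ := (integrable_congr hllr).2 (integrable_const _)
  rw [InformationTheory.klDiv_of_ac_of_integrable hac hint, integral_congr_ae hllr]
  simp

theorem jsDiv_of_mutuallySingular {Ω : Type*} [MeasurableSpace Ω] {μ ν : Measure Ω}
    [IsProbabilityMeasure μ] [IsProbabilityMeasure ν] (h : μ ⟂ₘ ν) :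
    jsDiv μ ν = ENNReal.ofReal (Real.log 2) := by
  have h' := klDiv_half_add_of_mutuallySingular h.symm
  rw [add_comm ν μ] at h'
  rw [jsDiv, klDiv_half_add_of_mutuallySingular h, h', ENNReal.add_div, ENNReal.add_halves]

theorem klDiv_eq_top_of_mutuallySingular {Ω : Type*} [MeasurableSpace Ω] {μ ν : Measure Ω}
    [NeZero μ] (h : μ ⟂ₘ ν) : InformationTheory.klDiv μ ν = ⊤ :=
  InformationTheory.klDiv_of_not_ac fun hac =>
    NeZero.ne μ (Measure.eq_zero_of_absolutelyContinuous_of_mutuallySingular hac h)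

/-! ### Null sets -/

/-- At a density point of a set on which `f` vanishes, the derivative of `f` vanishes, so the
regular part of a zero set is null. -/
theorem measure_zeroSet_fderiv_ne_zero {F : Type*} [NormedAddCommGroup F] [NormedSpace ℝ F]
    [FiniteDimensional ℝ F] [MeasurableSpace F] [BorelSpace F] (μ : Measure F)
    [μ.IsAddHaarMeasure] {V : Set F} (hV : IsOpen V) {f : F → ℝ} (hf : DifferentiableOn ℝ f V) :
    μ {z | z ∈ V ∧ f z = 0 ∧ fderiv ℝ f z ≠ 0} = 0 := by
  set Z := {z | z ∈ V ∧ f z = 0 ∧ fderiv ℝ f z ≠ 0} with hZ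
  rcases subsingleton_or_nontrivial F with hF | hF
  · have : Z = ∅ := eq_empty_of_forall_notMem fun z hz =>
      hz.2.2 (ContinuousLinearMap.ext fun v => by simp [Subsingleton.elim v 0])
    simp [this]
  obtain ⟨v, hv⟩ := exists_ne (0 : F)
  have hZm : MeasurableSet Z := by
    have h1 : MeasurableSet (V \ (V ∩ f ⁻¹' {0}ᶜ)) :=
      hV.measurableSet.diff
        (hf.continuousOn.isOpen_inter_preimage hV isOpen_compl_singleton).measurableSet
    have h2 : MeasurableSet {z | fderiv ℝ f z ≠ 0} :=
      (measurable_fderiv ℝ f) (measurableSet_singleton 0).compl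
    convert h1.inter h2 using 1
    ext z
    simp only [hZ, mem_ofPred_eq, mem_inter_iff, Set.mem_sdiff, mem_preimage, mem_compl_iff,
      mem_singleton_iff]
    tauto
  -- The density theorem concerns self-maps of `F`, so `f` is replaced by `f • v`.
  have happ : ApproximatesLinearOn (fun z => f z • v) (0 : F →L[ℝ] F) Z 0 := by
    intro x hx y hy
    simp [hx.2.1, hy.2.1]
  have hder : ∀ z ∈ Z,
      HasFDerivWithinAt (fun z => f z • v) ((fderiv ℝ f z).smulRight v) Z z := fun z hz =>
    ((hf.differentiableAt (hV.mem_nhds hz.1)).hasFDerivAt.smul_const v).hasFDerivWithinAt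
  have hae := happ.norm_fderiv_sub_le μ hZm _ hder
  rw [ae_restrict_iff' hZm] at hae
  refine measure_mono_null (fun z hz => ?_) hae
  simp only [mem_compl_iff, mem_ofPred_eq, Classical.not_imp, not_le]
  refine ⟨hz, ?_⟩
  rw [sub_zero, nnnorm_pos]
  intro h0
  refine hz.2.2 (ContinuousLinearMap.ext fun w => ?_)
  have := congrArg (fun L : F →L[ℝ] F => L w) h0
  simpa [hv] using this

/-- `C¹` maps are locally Lipschitz, so they preserve Hausdorff null sets. -/
theorem hausdorffMeasure_image_eq_zero {F G : Type*} [NormedAddCommGroup F] [NormedSpace ℝ F]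
    [FiniteDimensional ℝ F] [MeasurableSpace F] [BorelSpace F]
    [NormedAddCommGroup G] [NormedSpace ℝ G] [MeasurableSpace G] [BorelSpace G]
    {s : ℝ} (hs : 0 ≤ s) {g : F → G} {Z : Set F} (hg : ∀ z ∈ Z, ContDiffAt ℝ 1 g z)
    (hZ : (Measure.hausdorffMeasure s : Measure F) Z = 0) :
    (Measure.hausdorffMeasure s : Measure G) (g '' Z) = 0 := by
  set μ : OuterMeasure F :=
    OuterMeasure.comap g (Measure.hausdorffMeasure s : Measure G).toOuterMeasure with hμ
  have : ProperSpace F := FiniteDimensional.proper ℝ F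
  suffices h : μ Z = 0 by simpa [hμ] using h
  refine measure_null_of_locally_null Z fun z hz => ?_
  obtain ⟨K, t, ht, hK⟩ := (hg z hz).exists_lipschitzOnWith
  refine ⟨t ∩ Z, inter_mem (mem_nhdsWithin_of_mem_nhds ht) self_mem_nhdsWithin, ?_⟩
  have h1 := (hK.mono (inter_subset_left (t := Z))).hausdorffMeasure_image_le hs
  rw [measure_mono_null inter_subset_right hZ, mul_zero] at h1
  simpa [hμ] using h1

/-! ### The coordinate slices -/

/-- The linear embedding `ℝ^m → ℝ^d` onto the first `m` coordinates, padding with zeros; it drops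
coordinates if `d < m`. -/
noncomputable def sliceEmb (d m : ℕ) : E m →L[ℝ] E d :=
  LinearMap.toContinuousLinearMap
    { toFun := fun z => WithLp.toLp 2 fun i => if h : (i : ℕ) < m then z ⟨i, h⟩ else 0
      map_add' := fun x y => by
        ext i
        by_cases h : (i : ℕ) < m <;> simp [h]
      map_smul' := fun c x => by
        ext i
        by_cases h : (i : ℕ) < m <;> simp [h] }

theorem sliceEmb_apply {d m : ℕ} (z : E m) (i : Fin d) :
    sliceEmb d m z i = if h : (i : ℕ) < m then z ⟨i, h⟩ else 0 := rfl

theorem exists_sliceEmb_eq {d m : ℕ} (hm : m ≤ d) {y : E d} (hy : y ∈ slice d m) :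
    ∃ z, sliceEmb d m z = y := by
  refine ⟨WithLp.toLp 2 fun j => y ⟨j, j.2.trans_le hm⟩, ?_⟩
  ext i
  rw [sliceEmb_apply]
  split_ifs with h
  · rfl
  · exact (hy i (not_lt.1 h)).symm

theorem hausdorffMeasure_eq_zero_of_lt {k m : ℕ} (h : k < m) (Z : Set (E k)) :
    (Measure.hausdorffMeasure (m : ℝ) : Measure (E k)) Z = 0 := by
  have : dimH Z < ((m : NNReal) : ℝ≥0∞) := by
    refine (dimH_mono (subset_univ Z)).trans_lt ?_
    rw [Real.dimH_univ_eq_finrank, finrank_euclideanSpace_fin]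
    exact_mod_cast h
  simpa using hausdorffMeasure_of_dimH_lt this

instance isAddHaarMeasure_hausdorffMeasure_E (m : ℕ) :
    (Measure.hausdorffMeasure (m : ℝ) : Measure (E m)).IsAddHaarMeasure := by
  simpa using MeasureTheory.isAddHaarMeasure_hausdorffMeasure (E := E m)

/-! ### Charts and tangent vectors -/

theorem IsSmoothChart.contDiffAt {d : ℕ} {φ : OpenPartialHomeomorph (E d) (E d)}
    (h : IsSmoothChart φ) {x : E d} (hx : x ∈ φ.source) : ContDiffAt ℝ ∞ φ x :=
  h.1.contDiffAt (φ.open_source.mem_nhds hx)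

theorem IsSmoothChart.contDiffAt_symm {d : ℕ} {φ : OpenPartialHomeomorph (E d) (E d)}
    (h : IsSmoothChart φ) {y : E d} (hy : y ∈ φ.target) : ContDiffAt ℝ ∞ φ.symm y :=
  h.2.contDiffAt (φ.open_target.mem_nhds hy)

theorem IsSmoothChart.hasFDerivAt {d : ℕ} {φ : OpenPartialHomeomorph (E d) (E d)}
    (h : IsSmoothChart φ) {x : E d} (hx : x ∈ φ.source) :
    HasFDerivAt φ (fderiv ℝ φ x) x :=
  ((h.contDiffAt hx).differentiableAt (by simp)).hasFDerivAt

theorem IsSmoothChart.hasFDerivAt_symm {d : ℕ} {φ : OpenPartialHomeomorph (E d) (E d)}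
    (h : IsSmoothChart φ) {y : E d} (hy : y ∈ φ.target) :
    HasFDerivAt φ.symm (fderiv ℝ φ.symm y) y :=
  ((h.contDiffAt_symm hy).differentiableAt (by simp)).hasFDerivAt

theorem IsSmoothChart.fderiv_symm_fderiv {d : ℕ} {φ : OpenPartialHomeomorph (E d) (E d)}
    (h : IsSmoothChart φ) {x : E d} (hx : x ∈ φ.source) (v : E d) :
    fderiv ℝ φ.symm (φ x) (fderiv ℝ φ x v) = v := by
  have h1 := (h.hasFDerivAt_symm (φ.map_source hx)).comp x (h.hasFDerivAt hx)
  have h2 : HasFDerivAt (φ.symm ∘ φ) (ContinuousLinearMap.id ℝ (E d)) x :=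
    (hasFDerivAt_id x).congr_of_eventuallyEq <| by
      filter_upwards [φ.open_source.mem_nhds hx] with y hy using φ.left_inv hy
  exact congrArg (fun L : E d →L[ℝ] E d => L v) (h1.unique h2)

theorem IsSmoothChart.fderiv_fderiv_symm {d : ℕ} {φ : OpenPartialHomeomorph (E d) (E d)}
    (h : IsSmoothChart φ) {x : E d} (hx : x ∈ φ.source) (v : E d) :
    fderiv ℝ φ x (fderiv ℝ φ.symm (φ x) v) = v := by
  have h1 := (h.hasFDerivAt hx)
  nth_rw 2 [← φ.left_inv hx] at h1
  have h1 := h1.comp (φ x) (h.hasFDerivAt_symm (φ.map_source hx))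
  have h2 : HasFDerivAt (φ ∘ φ.symm) (ContinuousLinearMap.id ℝ (E d)) (φ x) :=
    (hasFDerivAt_id (φ x)).congr_of_eventuallyEq <| by
      filter_upwards [φ.open_target.mem_nhds (φ.map_source hx)] with y hy using φ.right_inv hy
  exact congrArg (fun L : E d →L[ℝ] E d => L v) (h1.unique h2)

/-- A chart carrying `S` into `slice d k` carries the velocities of curves in `S` into
`slice d k`: the coordinates of index at least `k` are constant along such curves. -/
theorem fderiv_mem_slice_of_mem_curveVelocities {d k : ℕ} {S : Set (E d)} {x v : E d}
    {φ : OpenPartialHomeomorph (E d) (E d)} (hφ : IsSmoothChart φ) (hx : x ∈ φ.source)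
    (hS : ∀ y ∈ φ.source, y ∈ S → φ y ∈ slice d k) (hv : v ∈ curveVelocities S x) :
    fderiv ℝ φ x v ∈ slice d k := by
  obtain ⟨ε, hε, γ, -, hγS, rfl, hγ⟩ := hv
  intro i hi
  have h1 : HasDerivAt (fun t => φ (γ t) i) (fderiv ℝ φ (γ 0) v i) 0 :=
    (EuclideanSpace.proj i : E d →L[ℝ] ℝ).hasFDerivAt.comp_hasDerivAt (0 : ℝ)
      ((hφ.hasFDerivAt hx).comp_hasDerivAt (0 : ℝ) hγ)
  have h2 : HasDerivAt (fun t => φ (γ t) i) 0 0 :=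
    (hasDerivAt_const (0 : ℝ) (0 : ℝ)).congr_of_eventuallyEq <| by
      filter_upwards [Ioo_mem_nhds (neg_lt_zero.2 hε) hε,
        hγ.continuousAt.preimage_mem_nhds (φ.open_source.mem_nhds hx)] with t ht ht'
      exact hS _ ht' (hγS t ht) i hi
  exact h1.unique h2

/-- Around a point of a submanifold, interior or not, some chart carries it into a slice. -/
theorem IsRegularSubmanifold.exists_chart {d p : ℕ} {P : Set (E d)}
    (hP : IsRegularSubmanifold p P) {x : E d} (hx : x ∈ P) :
    ∃ ψ : OpenPartialHomeomorph (E d) (E d), IsSmoothChart ψ ∧ x ∈ ψ.source ∧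
      ∀ y ∈ ψ.source, y ∈ P → ψ y ∈ slice d p := by
  rcases hP.2 x hx with ⟨-, ψ, h1, h2, h3⟩ | ⟨-, -, ψ, h1, h2, h3, -⟩
  · exact ⟨ψ, h1, h2, fun y hy hyP => (h3 y hy).1 hyP⟩
  · exact ⟨ψ, h1, h2, fun y hy hyP => ((h3 y hy).1 hyP).1⟩

/-- If `S` lies in `M` and `T` in `P` and they are transversal, then a coordinate function of a
chart of `P` that vanishes on `P` has nonzero derivative along `M`, computed in a chart of `M`. -/
theorem exists_fderiv_ne_zero_of_transversalAt {d m p : ℕ} (hm : m ≤ d) {S T : Set (E d)}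
    {x : E d} {φ ψ : OpenPartialHomeomorph (E d) (E d)} (hφ : IsSmoothChart φ)
    (hψ : IsSmoothChart ψ) (hxφ : x ∈ φ.source) (hxψ : x ∈ ψ.source)
    (hS : ∀ y ∈ φ.source, y ∈ S → φ y ∈ slice d m)
    (hT : ∀ y ∈ ψ.source, y ∈ T → ψ y ∈ slice d p)
    (h : TransversalAt S T x) {i : Fin d} (hi : p ≤ (i : ℕ)) :
    ∃ w : E m, fderiv ℝ ψ x (fderiv ℝ φ.symm (φ x) (sliceEmb d m w)) i ≠ 0 := by
  by_contra! hcon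
  set L : E d →L[ℝ] ℝ := (EuclideanSpace.proj i : E d →L[ℝ] ℝ).comp (fderiv ℝ ψ x) with hL
  have hSL : tangentSpaceAt S x ≤ LinearMap.ker L.toLinearMap := by
    refine Submodule.span_le.2 fun v hv => ?_
    obtain ⟨w, hw⟩ :=
      exists_sliceEmb_eq hm (fderiv_mem_slice_of_mem_curveVelocities hφ hxφ hS hv)
    have := hcon w
    rw [hw, hφ.fderiv_symm_fderiv hxφ] at this
    exact this
  have hTL : tangentSpaceAt T x ≤ LinearMap.ker L.toLinearMap :=
    Submodule.span_le.2 fun v hv =>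
      fderiv_mem_slice_of_mem_curveVelocities hψ hxψ hT hv i hi
  have htop : LinearMap.ker L.toLinearMap = ⊤ := top_le_iff.1 (h ▸ sup_le hSL hTL)
  have hmem : fderiv ℝ ψ.symm (ψ x) (EuclideanSpace.single i (1 : ℝ)) ∈
      LinearMap.ker L.toLinearMap := htop ▸ Submodule.mem_top
  have h0 : fderiv ℝ ψ x (fderiv ℝ ψ.symm (ψ x) (EuclideanSpace.single i (1 : ℝ))) i = 0 := hmem
  rw [hψ.fderiv_fderiv_symm hxψ] at h0
  simp at h0

/-! ### The intersection is null -/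

/-- In a chart of `M`, the intersection is contained in the zero set of a function whose derivative
does not vanish there, by transversality. -/
theorem hausdorffMeasure_interior_inter_eq_zero {d m p : ℕ} {M P : Set (E d)}
    (hP : IsRegularSubmanifold p P) (hm : m < d) (hp : p < d) (halign : ¬ PerfectlyAlign m p M P) :
    (Measure.hausdorffMeasure (m : ℝ) : Measure (E d)) (manifoldInterior m M ∩ P) = 0 := by
  refine measure_null_of_locally_null _ fun x₀ hx₀ => ?_
  obtain ⟨⟨-, φ, hφ, hxφ, hφM⟩, hxP⟩ := hx₀
  obtain ⟨ψ, hψ, hxψ, hψP⟩ := hP.exists_chart hxP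
  set Q := φ.source ∩ ψ.source with hQ
  refine ⟨(manifoldInterior m M ∩ P) ∩ Q, inter_mem self_mem_nhdsWithin
    (mem_nhdsWithin_of_mem_nhds
      ((φ.open_source.inter ψ.open_source).mem_nhds ⟨hxφ, hxψ⟩)), ?_⟩
  set g : E m → E d := fun z => φ.symm (sliceEmb d m z) with hg
  set i : Fin d := ⟨d - 1, by omega⟩ with hi
  have hpi : p ≤ (i : ℕ) := by simp only [hi]; omega
  -- the domain on which the last coordinate of `ψ` is read in the chart `φ`
  set V : Set (E m) := sliceEmb d m ⁻¹' (φ.target ∩ φ.symm ⁻¹' ψ.source) with hV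
  have hVo : IsOpen V :=
    (φ.isOpen_inter_preimage_symm ψ.open_source).preimage (sliceEmb d m).continuous
  have hgd : ∀ z ∈ V, HasFDerivAt g ((fderiv ℝ φ.symm (sliceEmb d m z)).comp (sliceEmb d m)) z :=
    fun z hz => (hφ.hasFDerivAt_symm hz.1).comp z (sliceEmb d m).hasFDerivAt
  have hfd : ∀ z ∈ V, HasFDerivAt (fun z => ψ (g z) i)
      ((EuclideanSpace.proj i : E d →L[ℝ] ℝ).comp ((fderiv ℝ ψ (g z)).comp
        ((fderiv ℝ φ.symm (sliceEmb d m z)).comp (sliceEmb d m)))) z := fun z hz =>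
    (EuclideanSpace.proj i : E d →L[ℝ] ℝ).hasFDerivAt.comp z
      ((hψ.hasFDerivAt hz.2).comp z (hgd z hz))
  have hnull := measure_zeroSet_fderiv_ne_zero
    (Measure.hausdorffMeasure (m : ℝ) : Measure (E m)) hVo
    (fun z hz => (hfd z hz).differentiableAt.differentiableWithinAt)
  refine measure_mono_null ?_ (hausdorffMeasure_image_eq_zero (Nat.cast_nonneg m)
    (g := g) (fun z hz => ?_) hnull)
  · rintro y ⟨⟨hyM, hyP⟩, hyφ, hyψ⟩
    obtain ⟨z, hz⟩ := exists_sliceEmb_eq hm.le ((hφM y hyφ).1 hyM.1)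
    have hgz : g z = y := by simp only [hg, hz, φ.left_inv hyφ]
    have hzV : z ∈ V := by
      refine ⟨?_, ?_⟩
      · rw [hz]; exact φ.map_source hyφ
      · rw [hz, mem_preimage, φ.left_inv hyφ]; exact hyψ
    refine ⟨z, ⟨hzV, ?_, ?_⟩, hgz⟩
    · rw [hgz]; exact hψP y hyψ hyP i hpi
    -- `T` will be `Int P` or `∂P`: both are contained in `P`, which is all that matters here.
    have hne : ∀ T ⊆ P, TransversalAt (manifoldInterior m M) T y →
        fderiv ℝ (fun z => ψ (g z) i) z ≠ 0 := by
      intro T hT htr h0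
      obtain ⟨w, hw⟩ := exists_fderiv_ne_zero_of_transversalAt hm.le hφ hψ hyφ hyψ
        (fun y' hy' hyM' => (hφM y' hy').1 hyM'.1) (fun y' hy' hyT => hψP y' hy' (hT hyT)) htr hpi
      rw [(hfd z hzV).fderiv] at h0
      have := congrArg (fun L : E m →L[ℝ] ℝ => L w) h0
      rw [hgz, hz] at this
      exact hw this
    simp only [PerfectlyAlign, PerfectlyAlignBoundaryless, not_or, not_exists, not_and,
      not_not] at halign
    rcases hP.2 y hyP with hy | hy
    · exact hne _ (fun _ h => h.1) (halign.1 y ⟨hyM, hy⟩)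
    · exact hne _ (fun _ h => h.1) (halign.2.1 y ⟨hyM, hy⟩)
  · exact ((hφ.contDiffAt_symm hz.1.1).comp z (sliceEmb d m).contDiff.contDiffAt).of_le (by simp)

/-- Around a boundary point, every point of `M` off the wall of the half-slice is interior. So the
complement of the interior locally embeds into dimension `m - 1`. -/
theorem hausdorffMeasure_diff_interior_eq_zero {d m : ℕ} {M : Set (E d)}
    (hM : IsRegularSubmanifold m M) (hm : m < d) :
    (Measure.hausdorffMeasure (m : ℝ) : Measure (E d)) (M \ manifoldInterior m M) = 0 := by
  refine measure_null_of_locally_null _ fun x₀ hx₀ => ?_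
  obtain ⟨-, h1m, φ, hφ, hxφ, hφM, -⟩ := (hM.2 x₀ hx₀.1).resolve_left hx₀.2
  refine ⟨(M \ manifoldInterior m M) ∩ φ.source, inter_mem self_mem_nhdsWithin
    (mem_nhdsWithin_of_mem_nhds (φ.open_source.mem_nhds hxφ)), ?_⟩
  set i : Fin d := ⟨m - 1, by omega⟩ with hi
  have hwall : ∀ y ∈ φ.source, y ∈ M \ manifoldInterior m M → φ y ∈ slice d (m - 1) := by
    intro y hy hyM
    have hyH := (hφM y hy).1 hyM.1
    have hyi : φ y i = 0 := by
      by_contra hne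
      have hpos : 0 < φ y i := (hyH.2 i (by simp only [hi]; omega)).lt_of_ne (Ne.symm hne)
      set O : Set (E d) := {w | 0 < w i} with hO
      have hOo : IsOpen O :=
        isOpen_lt continuous_const (EuclideanSpace.proj i : E d →L[ℝ] ℝ).continuous
      have hopen : IsOpen (φ.source ∩ φ ⁻¹' O) := φ.isOpen_inter_preimage hOo
      refine hyM.2 ⟨hyM.1, φ.restrOpen _ hopen, ⟨?_, ?_⟩, ⟨hy, hy, hpos⟩, ?_⟩
      · exact hφ.1.mono inter_subset_left
      · exact hφ.2.mono inter_subset_left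
      · intro w hw
        refine (hφM w hw.1).trans ⟨fun h => h.1, fun h => ⟨h, fun j hj => ?_⟩⟩
        have : j = i := Fin.ext (by simp only [hi]; omega)
        exact this ▸ le_of_lt hw.2.2
    intro j hj
    rcases eq_or_lt_of_le hj with h | h
    · rw [show j = i from Fin.ext h.symm]; exact hyi
    · exact hyH.1 j (by omega)
  refine measure_mono_null ?_ (hausdorffMeasure_image_eq_zero (Nat.cast_nonneg m)
    (g := fun z => φ.symm (sliceEmb d (m - 1) z)) (Z := sliceEmb d (m - 1) ⁻¹' φ.target)
    (fun z hz => ?_) (hausdorffMeasure_eq_zero_of_lt (by omega) _))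
  · rintro y ⟨hyM, hy⟩
    obtain ⟨z, hz⟩ := exists_sliceEmb_eq (by omega) (hwall y hy hyM)
    refine ⟨z, ?_, ?_⟩
    · rw [mem_preimage, hz]; exact φ.map_source hy
    · simp only [hz, φ.left_inv hy]
  · exact ((hφ.contDiffAt_symm hz).comp z (sliceEmb d (m - 1)).contDiff.contDiffAt).of_le (by simp)

/-- Only the `m`-dimensional measure of the intersection is needed: one of the two probability
measures ignoring `M ∩ P` already makes them mutually singular. -/
theorem hausdorffMeasure_inter_eq_zero {d m p : ℕ} {M P : Set (E d)}
    (hM : IsRegularSubmanifold m M) (hP : IsRegularSubmanifold p P) (hm : m < d) (hp : p < d)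
    (halign : ¬ PerfectlyAlign m p M P) :
    (Measure.hausdorffMeasure (m : ℝ) : Measure (E d)) (M ∩ P) = 0 := by
  refine measure_mono_null (fun x hx => ?_)
    (measure_union_null (hausdorffMeasure_interior_inter_eq_zero hP hm hp halign)
      (hausdorffMeasure_diff_interior_eq_zero hM hm))
  by_cases h : x ∈ manifoldInterior m M
  · exact Or.inl ⟨h, hx.2⟩
  · exact Or.inr ⟨hx.1, h⟩

end GANDivergence

theorem mainTheorem2 (d m p : ℕ) (M P : Set (GANDivergence.E d))
    (Pr Pg : Measure (GANDivergence.E d)) [IsProbabilityMeasure Pr] [IsProbabilityMeasure Pg]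
    (hM : GANDivergence.IsRegularSubmanifold m M) (hP : GANDivergence.IsRegularSubmanifold p P)
    (hm : m < d) (hp : p < d)
    (halign : ¬ GANDivergence.PerfectlyAlign m p M P)
    (hsuppr : Pr Mᶜ = 0) (hsuppg : Pg Pᶜ = 0)
    (hcontr : GANDivergence.ContinuousInManifold m M Pr)
    (hcontg : GANDivergence.ContinuousInManifold p P Pg) :
    GANDivergence.jsDiv Pr Pg = ENNReal.ofReal (Real.log 2) ∧
      InformationTheory.klDiv Pr Pg = ⊤ ∧
      InformationTheory.klDiv Pg Pr = ⊤ := by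
  have hnull : Pr P = 0 := by
    refine measure_mono_null (fun x hx => ?_) (measure_union_null
      (hcontr _ inter_subset_left
        (GANDivergence.hausdorffMeasure_inter_eq_zero hM hP hm hp halign)) hsuppr)
    by_cases h : x ∈ M
    · exact Or.inl ⟨h, hx⟩
    · exact Or.inr h
  -- `P` need not be Borel, so it is replaced by a measurable hull with the same `Pr`-measure.
  have hsing : Pr ⟂ₘ Pg :=
    ⟨toMeasurable Pr P, measurableSet_toMeasurable _ _, by rwa [measure_toMeasurable],
      measure_mono_null (compl_subset_compl.2 (subset_toMeasurable Pr P)) hsuppg⟩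
  exact ⟨GANDivergence.jsDiv_of_mutuallySingular hsing,
    GANDivergence.klDiv_eq_top_of_mutuallySingular hsing,
    GANDivergence.klDiv_eq_top_of_mutuallySingular hsing.symm⟩
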